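/- Let $A$ be a coherent quantale, i.e. a complete lattice with least element $0$ and greatest element $1$, together with an associative commutative multiplication with unit $1$ that distributes over arbitrary joins, such that every element is a join of compact elements, $1$ is compact, and the product of two compact elements is compact. An element $p<1$ of a commutative quantale whose unit is its greatest element $1$ is *$m$-prime* if $ab\le p$ implies $a\le p$ or $b\le p$. Let $\mathrm{Spec}(A)$ be the set of $m$-prime elements, $\mathrm{Min}(A)$ the set of minimal elements of $\mathrm{Spec}(A)$, and $V(a)=\{p\in\mathrm{Spec}(A): a\le p\}$. Such a quantale is an *mp-quantale* if for every $m$-prime $p$ there is a unique minimal $m$-prime $q$ with $q\le p$; an *mp-frame* is an mp-quantale whose multiplication is the meet. Put $\rho(a)=\bigwedge\{p\in\mathrm{Spec}(A): a\le p\}$. Let $R(A)=\{a\in A:\rho(a)=a\}$, with the order inherited from $A$, joins $\rho(\bigvee_i a_i)$ and the meet as multiplication, and let $[\rho(0))=\{x\in A:\rho(0)\le x\}$, with the order inherited from $A$ and the multiplication $x\cdot y=xy\vee\rho(0)$. The Zariski topology on $\mathrm{Spec}(A)$ has the sets $V(a)$, $a\in A$, as its closed sets. $\mathrm{Spec}_F(A)$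 is the set $\mathrm{Spec}(A)$ with the flat topology, which has the complements of the Zariski-compact Zariski-open sets as a basis of open sets, and $\mathrm{Min}_F(A)$ is $\mathrm{Min}(A)$ with the subspace topology of $\mathrm{Spec}_F(A)$. The following are equivalent: 1. $A$ is an mp-quantale; 2. for any distinct $p,q\in\mathrm{Min}(A)$ we have $p\vee q=1$; 3. $R(A)$ is an mp-frame; 4. $[\rho(0))$ is an mp-quantale; 5. the inclusion $\mathrm{Min}_F(A)\subseteq\mathrm{Spec}_F(A)$ has a continuous retraction, i.e. there is a continuous map $r:\mathrm{Spec}_F(A)\to\mathrm{Min}_F(A)$ with $r(p)=p$ for all $p\in\mathrm{Min}(A)$; 6. $\mathrm{Spec}_F(A)$ is normal, i.e. any two disjoint closed subsets have disjoint open neighbourhoods (no separation of points is assumed); 7. for every $p\in\mathrm{Min}(A)$ the set $V(p)$ is closed in $\mathrm{Spec}_F(A)$. -/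

import Mathlib

namespace QuantaleSpectrum

/-- A (commutative, unital) quantale is integral if the multiplicative unit is the top element. -/
class IsIntegralQuantale (A : Type*) [CommMonoid A] [CompleteLattice A] : Prop where
  one_eq_top : (1 : A) = ⊤

/-- A coherent quantale: every element is a join of compact elements, the top element `1` is
compact, and the compact elements are closed under multiplication. -/
structure IsCoherentQuantale (A : Type*) [CommMonoid A] [CompleteLattice A] : Prop where
  algebraic : ∀ a : A, ∃ X : Set A, (∀ c ∈ X, IsCompactElement c) ∧ a = sSup X
  compact_one : IsCompactElement (1 : A)
  compact_mul : ∀ c d : A, IsCompactElement c → IsCompactElement d → IsCompactElement (c * d)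

section Basic

variable {A : Type*} [CommMonoid A] [CompleteLattice A]

/-- `m`-prime elements. -/
structure IsMPrime (p : A) : Prop where
  lt_one : p < 1
  le_or_le : ∀ a b : A, a * b ≤ p → a ≤ p ∨ b ≤ p

/-- Minimal `m`-prime elements, i.e. the members of `Min(A)`. -/
def IsMinMPrime (q : A) : Prop := Minimal (IsMPrime (A := A)) q

/-- The radical `ρ(a)`: the meet of all `m`-prime elements above `a`. -/
def radical (a : A) : A := sInf {p : A | IsMPrime p ∧ a ≤ p}

end Basic

/-- An `mp`-quantale: every `m`-prime element lies above a unique minimal `m`-prime element. -/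
def IsMpQuantale (A : Type*) [CommMonoid A] [CompleteLattice A] [IsQuantale A]
    [IsIntegralQuantale A] : Prop :=
  ∀ p : A, IsMPrime p → ∃! q : A, IsMinMPrime q ∧ q ≤ p

/-- A quantale is a frame if its multiplication is the meet. -/
def IsFrameQuantale (A : Type*) [CommMonoid A] [CompleteLattice A] [IsQuantale A] : Prop :=
  ∀ a b : A, a * b = a ⊓ b

/-- An `mp`-frame is an `mp`-quantale which is a frame. -/
def IsMpFrame (A : Type*) [CommMonoid A] [CompleteLattice A] [IsQuantale A]
    [IsIntegralQuantale A] : Prop :=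
  IsMpQuantale A ∧ IsFrameQuantale A

section Integral

variable {A : Type*} [CommMonoid A] [CompleteLattice A]

theorem le_radical (a : A) : a ≤ radical a := le_sInf fun _ h => h.2

theorem radical_mono {a b : A} (h : a ≤ b) : radical a ≤ radical b :=
  sInf_le_sInf fun _ hp => ⟨hp.1, h.trans hp.2⟩

theorem radical_le_iff {a p : A} (hp : IsMPrime p) : radical a ≤ p ↔ a ≤ p :=
  ⟨(le_radical a).trans, fun h => sInf_le ⟨hp, h⟩⟩

theorem radical_idem (a : A) : radical (radical a) = radical a :=
  le_antisymm (le_sInf fun _ hp => (radical_le_iff hp.1).2 ((radical_le_iff hp.1).2 hp.2))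
    (le_radical _)

theorem radical_eq_of_le {a : A} (h : radical a ≤ a) : radical a = a :=
  le_antisymm h (le_radical a)

variable [IsQuantale A] [IsIntegralQuantale A]

theorem mul_le_left_factor (a b : A) : a * b ≤ a := by
  calc a * b ≤ a * 1 := by
        gcongr
        rw [IsIntegralQuantale.one_eq_top]; exact le_top
    _ = a := mul_one a

theorem mul_le_right_factor (a b : A) : a * b ≤ b := by
  rw [mul_comm]; exact mul_le_left_factor b a

end Integral

section Radical

variable (A : Type*) [CommMonoid A] [CompleteLattice A]

/-- The set `R(A)` of radical elements of `A`, i.e. those with `ρ(a) = a`. -/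
def RadicalElements : Type _ := {a : A // radical a = a}

instance : PartialOrder (RadicalElements A) :=
  inferInstanceAs (PartialOrder {a : A // radical a = a})

/-- The order on `R(A)` is inherited from `A`; joins are the radicals of the joins in `A` and
meets are the meets of `A`. -/
instance : CompleteLattice (RadicalElements A) where
  sup x y := ⟨radical (x.1 ⊔ y.1), radical_idem _⟩
  le_sup_left x y := (le_sup_left (a := x.1) (b := y.1)).trans (le_radical _)
  le_sup_right x y := (le_sup_right (a := x.1) (b := y.1)).trans (le_radical _)
  sup_le x y z hx hy := (radical_mono (sup_le (c := z.1) hx hy)).trans_eq z.2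
  inf x y := ⟨x.1 ⊓ y.1, radical_eq_of_le (le_inf
    ((radical_mono inf_le_left).trans_eq x.2) ((radical_mono inf_le_right).trans_eq y.2))⟩
  inf_le_left x y := inf_le_left (a := x.1) (b := y.1)
  inf_le_right x y := inf_le_right (a := x.1) (b := y.1)
  le_inf x y z hy hz := show x.1 ≤ y.1 ⊓ z.1 from le_inf hy hz
  sSup S := ⟨radical (sSup (Subtype.val '' S)), radical_idem _⟩
  sInf S := ⟨sInf (Subtype.val '' S), radical_eq_of_le (le_sInf (by
    rintro _ ⟨x, hx, rfl⟩
    exact (radical_mono (b := x.1) (sInf_le (Set.mem_image_of_mem Subtype.val hx))).trans_eq x.2))⟩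
  isLUB_sSup S := ⟨fun x hx => (le_sSup (Set.mem_image_of_mem Subtype.val hx)).trans (le_radical _),
    fun z hz => (radical_mono (b := z.1)
      (sSup_le (by rintro _ ⟨x, hx, rfl⟩; exact hz hx))).trans_eq z.2⟩
  isGLB_sInf S := ⟨fun x hx => sInf_le (Set.mem_image_of_mem Subtype.val hx),
    fun z hz => show z.1 ≤ sInf (Subtype.val '' S) from
      le_sInf (by rintro _ ⟨x, hx, rfl⟩; exact hz hx)⟩
  top := ⟨⊤, radical_eq_of_le le_top⟩
  le_top x := le_top (a := x.1)
  bot := ⟨radical ⊥, radical_idem _⟩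
  bot_le x := (radical_mono (bot_le (a := x.1))).trans_eq x.2

/-- The multiplication of `R(A)` is the meet. -/
instance : CommMonoid (RadicalElements A) where
  mul x y := x ⊓ y
  mul_assoc := inf_assoc
  mul_comm := inf_comm
  one := ⊤
  one_mul := top_inf_eq
  mul_one := inf_top_eq

instance : IsIntegralQuantale (RadicalElements A) := ⟨rfl⟩

theorem radicalElements_mul_sSup [IsQuantale A] [IsIntegralQuantale A]
    (x : RadicalElements A) (S : Set (RadicalElements A)) : x * sSup S = ⨆ y ∈ S, x * y := by
  refine le_antisymm ?_ (iSup₂_le fun y hy => inf_le_inf_left x (le_sSup hy))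
  generalize ht : (⨆ y ∈ S, x * y) = t
  have key : ∀ y ∈ S, x * y ≤ t := fun y hy => ht ▸ le_iSup₂ (f := fun y _ => x * y) y hy
  change x.1 ⊓ radical (sSup (Subtype.val '' S)) ≤ t.1
  rw [← t.2]
  refine le_sInf fun p ⟨hp, htp⟩ => ?_
  by_cases hx : x.1 ≤ p
  · exact inf_le_left.trans hx
  · refine inf_le_right.trans ((radical_le_iff hp).2 (sSup_le ?_))
    rintro _ ⟨y, hy, rfl⟩
    have h1 : x.1 * y.1 ≤ x.1 ⊓ y.1 :=
      le_inf (mul_le_left_factor _ _) (mul_le_right_factor _ _)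
    have h2 : x.1 ⊓ y.1 ≤ t.1 := key y hy
    exact (hp.le_or_le _ _ (h1.trans (h2.trans htp))).resolve_left hx

instance [IsQuantale A] [IsIntegralQuantale A] : IsQuantale (RadicalElements A) where
  mul_sSup_distrib := radicalElements_mul_sSup A
  sSup_mul_distrib S x := by
    rw [mul_comm, radicalElements_mul_sSup]
    simp only [mul_comm]

end Radical

section Interval

variable {A : Type*} [CommMonoid A] [CompleteLattice A]

/-- The interval `[a) = {x ∈ A | a ≤ x}`. -/
def Above (a : A) : Type _ := {x : A // a ≤ x}

variable (a : A)

instance : PartialOrder (Above a) := inferInstanceAs (PartialOrder {x : A // a ≤ x})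

/-- The order on `[a)` is inherited from `A`. -/
instance : CompleteLattice (Above a) where
  sup x y := ⟨x.1 ⊔ y.1, x.2.trans le_sup_left⟩
  le_sup_left x y := le_sup_left (a := x.1) (b := y.1)
  le_sup_right x y := le_sup_right (a := x.1) (b := y.1)
  sup_le x y z hx hy := sup_le (c := z.1) hx hy
  inf x y := ⟨x.1 ⊓ y.1, le_inf x.2 y.2⟩
  inf_le_left x y := inf_le_left (a := x.1) (b := y.1)
  inf_le_right x y := inf_le_right (a := x.1) (b := y.1)
  le_inf x y z hy hz := show x.1 ≤ y.1 ⊓ z.1 from le_inf hy hz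
  sSup S := ⟨sSup (Subtype.val '' S) ⊔ a, le_sup_right⟩
  sInf S := ⟨sInf (Subtype.val '' S), le_sInf (by rintro _ ⟨x, _, rfl⟩; exact x.2)⟩
  isLUB_sSup S := ⟨fun x hx => (le_sSup (Set.mem_image_of_mem Subtype.val hx)).trans le_sup_left,
    fun z hz => sup_le (c := z.1) (sSup_le (by rintro _ ⟨x, hx, rfl⟩; exact hz hx)) z.2⟩
  isGLB_sInf S := ⟨fun x hx => sInf_le (Set.mem_image_of_mem Subtype.val hx),
    fun z hz => show z.1 ≤ sInf (Subtype.val '' S) from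
      le_sInf (by rintro _ ⟨x, hx, rfl⟩; exact hz hx)⟩
  top := ⟨⊤, le_top⟩
  le_top x := le_top (a := x.1)
  bot := ⟨a, le_rfl⟩
  bot_le x := x.2

variable [IsQuantale A] [IsIntegralQuantale A]

open Quantale in
theorem sup_mul_sup_assoc (x y z : A) : ((x * y) ⊔ a) * z ⊔ a = x * ((y * z) ⊔ a) ⊔ a := by
  rw [sup_mul_distrib, mul_sup_distrib, sup_assoc, sup_assoc,
    sup_eq_right.2 (mul_le_left_factor a z), sup_eq_right.2 (mul_le_right_factor x a), mul_assoc]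

/-- The multiplication of `[a)` is `x ·ₐ y = x y ∨ a`, with unit the top element. -/
instance : CommMonoid (Above a) where
  mul x y := ⟨x.1 * y.1 ⊔ a, le_sup_right⟩
  mul_assoc x y z := Subtype.ext (sup_mul_sup_assoc a x.1 y.1 z.1)
  mul_comm x y := Subtype.ext (congrArg (· ⊔ a) (mul_comm x.1 y.1))
  one := ⊤
  one_mul x := Subtype.ext (by
    change (⊤ : A) * x.1 ⊔ a = x.1
    rw [← IsIntegralQuantale.one_eq_top, one_mul]; exact sup_eq_left.2 x.2)
  mul_one x := Subtype.ext (by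
    change x.1 * (⊤ : A) ⊔ a = x.1
    rw [← IsIntegralQuantale.one_eq_top, mul_one]; exact sup_eq_left.2 x.2)

instance : IsIntegralQuantale (Above a) := ⟨rfl⟩

open Quantale in
theorem above_mul_sSup (x : Above a) (S : Set (Above a)) : x * sSup S = ⨆ y ∈ S, x * y := by
  have mono : ∀ y z : Above a, y ≤ z → x * y ≤ x * z := fun y z h =>
    sup_le_sup_right (mul_le_mul_right (show y.1 ≤ z.1 from h) x.1) a
  refine le_antisymm ?_ (iSup₂_le fun y hy => mono _ _ (le_sSup hy))
  generalize ht : (⨆ y ∈ S, x * y) = t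
  have key : ∀ y ∈ S, x * y ≤ t := fun y hy => ht ▸ le_iSup₂ (f := fun y _ => x * y) y hy
  change x.1 * (sSup (Subtype.val '' S) ⊔ a) ⊔ a ≤ t.1
  rw [mul_sup_distrib, mul_sSup_distrib]
  refine sup_le (sup_le (iSup₂_le ?_) ((mul_le_right_factor _ _).trans t.2)) t.2
  rintro _ ⟨y, hy, rfl⟩
  exact le_sup_left.trans (show x.1 * y.1 ⊔ a ≤ t.1 from key y hy)

instance : IsQuantale (Above a) where
  mul_sSup_distrib := above_mul_sSup a
  sSup_mul_distrib S x := by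
    rw [mul_comm, above_mul_sSup]
    simp only [mul_comm]

end Interval

section Spectrum

variable (A : Type*) [CommMonoid A] [CompleteLattice A]

/-- The set `Spec(A)` of `m`-prime elements; as a topological space it is `Spec_Z(A)`. -/
def Spec : Type _ := {p : A // IsMPrime p}

variable {A} in
/-- `V(a) = {p ∈ Spec(A) | a ≤ p}`. -/
def V (a : A) : Set (Spec A) := {p | a ≤ p.1}

/-- `Min(A)` as a subset of `Spec(A)`. -/
def minSpec : Set (Spec A) := {p | IsMinMPrime p.1}

/-- The Zariski topology on `Spec(A)`: the closed sets are exactly the sets `V(a)`, `a ∈ A`. -/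
instance [IsQuantale A] [IsIntegralQuantale A] : TopologicalSpace (Spec A) :=
  TopologicalSpace.ofClosed (Set.range (V (A := A)))
    ⟨1, Set.eq_empty_of_forall_notMem fun p hp => not_le_of_gt p.2.lt_one hp⟩
    (fun T hT => ⟨sSup {a : A | V a ∈ T}, by
      ext p
      constructor
      · intro hp s hs
        obtain ⟨a, rfl⟩ := hT hs
        exact (le_sSup (show a ∈ {a : A | V a ∈ T} from hs)).trans hp
      · intro hp
        exact sSup_le fun a ha => hp (V a) ha⟩)
    (by
      rintro _ ⟨a, rfl⟩ _ ⟨b, rfl⟩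
      refine ⟨a * b, ?_⟩
      ext p
      constructor
      · exact p.2.le_or_le a b
      · rintro (h | h)
        · exact (mul_le_left_factor a b).trans h
        · exact (mul_le_right_factor a b).trans h)

/-- The flat topology associated with a spectral space `X`: it has the complements of the compact
open subsets of `X` as a basis. -/
@[reducible] def flatTopology (X : Type*) [TopologicalSpace X] : TopologicalSpace X :=
  TopologicalSpace.generateFrom {s | ∃ U : Set X, IsOpen U ∧ IsCompact U ∧ s = Uᶜ}

/-- The space `Spec_F(A)`: the set `Spec(A)` with the flat topology. -/
def FlatSpec : Type _ := Spec A

instance [IsQuantale A] [IsIntegralQuantale A] : TopologicalSpace (FlatSpec A) :=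
  flatTopology (Spec A)

variable {A} in
/-- `V(a)` as a subset of `Spec_F(A)`. -/
def flatV (a : A) : Set (FlatSpec A) := V a

/-- The space `Min_F(A)`: the set `Min(A)` with the subspace topology inherited from
`Spec_F(A)`. -/
def FlatMin : Type _ := {p : FlatSpec A // p ∈ minSpec A}

instance [IsQuantale A] [IsIntegralQuantale A] : TopologicalSpace (FlatMin A) :=
  inferInstanceAs (TopologicalSpace {p : FlatSpec A // p ∈ minSpec A})

variable {A} in
/-- The inclusion `Min_F(A) ⊆ Spec_F(A)`. -/
def FlatMin.incl (p : FlatMin A) : FlatSpec A := p.1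

end Spectrum

end QuantaleSpectrum

open QuantaleSpectrum

namespace QuantaleSpectrum

/-! ### Existence of m-primes and of minimal m-primes. -/

section Primes

variable {A : Type*} [CommMonoid A] [CompleteLattice A]

/-! Everything passes through condition 2. Every element other than `1` lies below an m-prime, so `p
⊔ q ≠ 1` means that some m-prime `m` lies above both `p` and `q`; hence 2 is equivalent to 1.
Conditions 3 and 4 follow because 1 depends only on the ordered set of m-primes, which `R(A)` and
`[ρ(0))` share with `A`.

By coherence, the sets `V(c)` with `c` compact generate the flat topology. So open sets are upward
closed, closed sets are downward closed, and minimal primes are closed points. If `m` lay above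
distinct minimal `p` and `q`, a retraction would send `m` to both, neighbourhoods of `p` and `q`
would meet in `m`, and a closed `V(p)` would contain `q`: each of 5, 6, 7 forces 2.

Conversely, if `p ⊔ q = 1`, compactness of `1` gives compact `c ≤ p` and `d ≤ q` with `c ⊔ d = 1`,
so `V(c)` and `V(d)` are disjoint open sets around `V(p)` and `V(q)`. This gives 7 at once;
compactness of the flat topology extends the separation from points to closed sets, giving 5 and 6.
-/

theorem IsMPrime.sInf_of_isChain {C : Set A} (hC : IsChain (· ≤ ·) C) (hne : C.Nonempty)
    (hp : ∀ p ∈ C, IsMPrime p) : IsMPrime (sInf C) := by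
  obtain ⟨p, hpC⟩ := hne
  refine ⟨(sInf_le hpC).trans_lt (hp p hpC).lt_one, fun a b hab => ?_⟩
  by_contra! h
  obtain ⟨h₁, h₂⟩ := h
  simp only [le_sInf_iff, not_forall] at h₁ h₂
  obtain ⟨x, hx, hax⟩ := h₁
  obtain ⟨y, hy, hby⟩ := h₂
  rcases hC.total hx hy with hxy | hxy
  · exact ((hp x hx).le_or_le a b (hab.trans (sInf_le hx))).elim hax fun h => hby (h.trans hxy)
  · exact ((hp y hy).le_or_le a b (hab.trans (sInf_le hy))).elim (fun h => hax (h.trans hxy)) hby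

theorem IsMPrime.exists_isMinMPrime_le {p : A} (hp : IsMPrime p) : ∃ q, IsMinMPrime q ∧ q ≤ p := by
  obtain ⟨q, hqp, hq⟩ := zorn_le_nonempty₀ (α := Aᵒᵈ) {q : Aᵒᵈ | IsMPrime (OrderDual.ofDual q)}
    (fun C hC hchain y hy => ⟨OrderDual.toDual (sInf (OrderDual.toDual ⁻¹' C)),
      IsMPrime.sInf_of_isChain (C := OrderDual.toDual ⁻¹' C)
        (fun a ha b hb hab => (hchain ha hb hab).symm) ⟨_, hy⟩ fun p hp => hC hp,
      fun z hz => sInf_le (α := A) hz⟩) (OrderDual.toDual p) hp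
  exact ⟨OrderDual.ofDual q, ⟨hq.1, fun r hr hrq => hq.2 (y := OrderDual.toDual r) hr hrq⟩, hqp⟩

theorem IsMinMPrime.eq_of_le {p q : A} (hq : IsMinMPrime q) (hp : IsMPrime p) (h : p ≤ q) :
    p = q := le_antisymm h (hq.2 hp h)

theorem IsMPrime.of_pow_le {p : A} (hp : IsMPrime p) {c : A} {n : ℕ} (h : c ^ n ≤ p) : c ≤ p := by
  induction n with
  | zero => exact absurd hp.lt_one (by simpa using not_lt_of_ge h)
  | succ n ih =>
    rw [pow_succ] at h
    exact (hp.le_or_le _ _ h).elim ih id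

theorem IsMPrime.not_one_le {p : A} (hp : IsMPrime p) : ¬ 1 ≤ p := not_le_of_gt hp.lt_one

theorem le_one [IsIntegralQuantale A] (a : A) : a ≤ 1 := by
  rw [IsIntegralQuantale.one_eq_top]; exact le_top

variable [IsQuantale A] [IsIntegralQuantale A]

open Quantale in
/-- Prime separation: an element which lies above no member of a submonoid of compact elements
extends to an `m`-prime element with the same property. -/
theorem exists_isMPrime_of_submonoid (M : Submonoid A) (hM : ∀ s ∈ M, IsCompactElement s) (a : A)
    (ha : ∀ s ∈ M, ¬ s ≤ a) : ∃ p, IsMPrime p ∧ a ≤ p ∧ ∀ s ∈ M, ¬ s ≤ p := by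
  obtain ⟨p, hap, hp⟩ := zorn_le_nonempty₀ {x : A | ∀ s ∈ M, ¬ s ≤ x}
    -- A compact `s` below the join of a chain is already below one of its members.
    (fun C hC hchain y hy => ⟨sSup C, fun s hs hsC => by
      obtain ⟨x, hx, hsx⟩ := hM s hs C _ ⟨y, hy⟩ hchain.directedOn (isLUB_sSup C) hsC
      exact hC hx s hs hsx, fun z hz => le_sSup hz⟩) a ha
  have key : ∀ b, ¬ b ≤ p → ∃ s ∈ M, s ≤ p ⊔ b := fun b hb => by
    by_contra! h
    exact hb (le_sup_right.trans (hp.2 (y := p ⊔ b) h le_sup_left))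
  refine ⟨p, ⟨lt_of_le_not_ge (le_one p) (hp.1 1 M.one_mem), fun b c hbc => ?_⟩, hap, hp.1⟩
  by_contra! h
  obtain ⟨s, hs, hsb⟩ := key b h.1
  obtain ⟨t, ht, htc⟩ := key c h.2
  refine hp.1 (s * t) (M.mul_mem hs ht) ?_
  calc s * t ≤ (p ⊔ b) * (p ⊔ c) := mul_le_mul' hsb htc
    _ ≤ p := by
      rw [sup_mul_distrib, mul_sup_distrib (x := b)]
      exact sup_le (mul_le_left_factor _ _) (sup_le (mul_le_right_factor _ _) hbc)

end Primes

/-! ### Invariance under an isomorphism of the posets of m-primes. -/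

section Transfer

variable {A B : Type*} [CommMonoid A] [CompleteLattice A] [CommMonoid B] [CompleteLattice B]

theorem isMinMPrime_map_iff {f : B → A} (hle : ∀ x y, f x ≤ f y ↔ x ≤ y)
    (hf : ∀ x, IsMPrime (f x) ↔ IsMPrime x) (hrange : ∀ p, IsMPrime p → p ∈ Set.range f) (x : B) :
    IsMinMPrime (f x) ↔ IsMinMPrime x := by
  constructor
  · exact fun h => ⟨(hf x).1 h.1, fun y hy hyx =>
      (hle _ _).1 (h.2 ((hf y).2 hy) ((hle _ _).2 hyx))⟩
  · refine fun h => ⟨(hf x).2 h.1, fun p hp hpx => ?_⟩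
    obtain ⟨y, rfl⟩ := hrange p hp
    exact (hle _ _).2 (h.2 ((hf y).1 hp) ((hle _ _).1 hpx))

variable [IsQuantale A] [IsIntegralQuantale A] [IsQuantale B] [IsIntegralQuantale B]

/-- Being an `mp`-quantale only depends on the ordered set of `m`-prime elements. -/
theorem isMpQuantale_iff_of_map {f : B → A} (hle : ∀ x y, f x ≤ f y ↔ x ≤ y)
    (hf : ∀ x, IsMPrime (f x) ↔ IsMPrime x) (hrange : ∀ p, IsMPrime p → p ∈ Set.range f) :
    IsMpQuantale A ↔ IsMpQuantale B := by
  have hmin := isMinMPrime_map_iff hle hf hrange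
  have hinj : ∀ x y, f x = f y → x = y := fun x y h =>
    le_antisymm ((hle _ _).1 h.le) ((hle _ _).1 h.ge)
  constructor
  · intro h x hx
    obtain ⟨q, ⟨hq, hqx⟩, huniq⟩ := h (f x) ((hf x).2 hx)
    obtain ⟨y, rfl⟩ := hrange q hq.1
    exact ⟨y, ⟨(hmin y).1 hq, (hle _ _).1 hqx⟩, fun z hz =>
      hinj _ _ (huniq (f z) ⟨(hmin z).2 hz.1, (hle _ _).2 hz.2⟩)⟩
  · intro h p hp
    obtain ⟨x, rfl⟩ := hrange p hp
    obtain ⟨y, ⟨hy, hyx⟩, huniq⟩ := h x ((hf x).1 hp)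
    refine ⟨f y, ⟨(hmin y).2 hy, (hle _ _).2 hyx⟩, ?_⟩
    rintro q ⟨hq, hqx⟩
    obtain ⟨z, rfl⟩ := hrange q hq.1
    exact congrArg f (huniq z ⟨(hmin z).1 hq, (hle _ _).1 hqx⟩)

end Transfer

/-! ### The m-primes of `R(A)` and of `[a)`. -/

section Reductions

variable {A : Type*} [CommMonoid A] [CompleteLattice A]

theorem IsMPrime.radical_eq {p : A} (hp : IsMPrime p) : radical p = p :=
  le_antisymm ((radical_le_iff hp).2 le_rfl) (le_radical p)

theorem radical_inf_radical_le {a b p : A} (hp : IsMPrime p) (hab : a * b ≤ p) :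
    radical a ⊓ radical b ≤ p :=
  (hp.le_or_le a b hab).elim (fun h => inf_le_left.trans ((radical_le_iff hp).2 h))
    fun h => inf_le_right.trans ((radical_le_iff hp).2 h)

variable [IsQuantale A] [IsIntegralQuantale A]

/-- The meet in `R(A)` may exceed the product in `A`, but an m-prime above `a * b` is also above
`radical a ⊓ radical b`, and `x` is the meet of the m-primes of `A` above it. -/
theorem radicalElements_isMPrime_iff (x : RadicalElements A) : IsMPrime x.1 ↔ IsMPrime x := by
  have lt_iff : x.1 < 1 ↔ x < 1 := by
    rw [show (1 : A) = (1 : RadicalElements A).1 from IsIntegralQuantale.one_eq_top]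
    exact Iff.rfl
  constructor
  · refine fun h => ⟨lt_iff.1 h.lt_one, fun y z hyz => h.le_or_le y.1 z.1 ?_⟩
    exact le_trans (le_inf (mul_le_left_factor _ _) (mul_le_right_factor _ _))
      (show y.1 ⊓ z.1 ≤ x.1 from hyz)
  · refine fun h => ⟨lt_iff.2 h.lt_one, fun a b hab => ?_⟩
    refine (h.le_or_le ⟨radical a, radical_idem a⟩ ⟨radical b, radical_idem b⟩ ?_).imp
      (le_radical a).trans (le_radical b).trans
    change radical a ⊓ radical b ≤ x.1
    rw [← x.2]
    exact le_sInf fun p hp => radical_inf_radical_le hp.1 (hab.trans hp.2)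

theorem isMpQuantale_iff_isMpFrame_radicalElements :
    IsMpQuantale A ↔ IsMpFrame (RadicalElements A) := by
  rw [isMpQuantale_iff_of_map (f := fun x : RadicalElements A => x.1) (fun _ _ => Iff.rfl)
    radicalElements_isMPrime_iff fun p hp => ⟨⟨p, hp.radical_eq⟩, rfl⟩]
  exact ⟨fun h => ⟨h, fun _ _ => rfl⟩, fun h => h.1⟩

open Quantale in
theorem above_isMPrime_iff {a : A} (x : Above a) : IsMPrime x.1 ↔ IsMPrime x := by
  have lt_iff : x.1 < 1 ↔ x < 1 := by
    rw [show (1 : A) = (1 : Above a).1 from IsIntegralQuantale.one_eq_top]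
    exact Iff.rfl
  constructor
  · exact fun h => ⟨lt_iff.1 h.lt_one, fun y z hyz => h.le_or_le y.1 z.1
      (le_sup_left.trans (show y.1 * z.1 ⊔ a ≤ x.1 from hyz))⟩
  · refine fun h => ⟨lt_iff.2 h.lt_one, fun b c hbc => ?_⟩
    -- Once expanded, the product of `b ⊔ a` and `c ⊔ a` differs from `b * c` only by terms below
    -- `a`.
    refine (h.le_or_le ⟨b ⊔ a, le_sup_right⟩ ⟨c ⊔ a, le_sup_right⟩ ?_).imp
      le_sup_left.trans le_sup_left.trans
    change (b ⊔ a) * (c ⊔ a) ⊔ a ≤ x.1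
    rw [sup_mul_distrib, mul_sup_distrib (x := b)]
    exact sup_le (sup_le (sup_le hbc ((mul_le_right_factor _ _).trans x.2))
      ((mul_le_left_factor _ _).trans x.2)) x.2

theorem isMpQuantale_iff_above {a : A} (ha : ∀ p, IsMPrime p → a ≤ p) :
    IsMpQuantale A ↔ IsMpQuantale (Above a) :=
  isMpQuantale_iff_of_map (f := fun x : Above a => x.1) (fun _ _ => Iff.rfl)
    above_isMPrime_iff fun p hp => ⟨⟨p, ha p hp⟩, rfl⟩

end Reductions

/-! ### Compact elements and prime separation in a coherent quantale. -/

namespace IsCoherentQuantale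

variable {A : Type*} [CommMonoid A] [CompleteLattice A]

theorem le_iff (hA : IsCoherentQuantale A) {a b : A} :
    a ≤ b ↔ ∀ c, IsCompactElement c → c ≤ a → c ≤ b := by
  refine ⟨fun h c _ hc => hc.trans h, fun h => ?_⟩
  obtain ⟨X, hX, rfl⟩ := hA.algebraic a
  exact sSup_le fun c hc => h c (hX c hc) (le_sSup hc)

/-- The submonoid of compact elements. -/
def compactSubmonoid (hA : IsCoherentQuantale A) : Submonoid A where
  carrier := {c | IsCompactElement c}
  mul_mem' := hA.compact_mul _ _
  one_mem' := hA.compact_one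

/-- The joins `c ⊔ d` of compact elements below `a` and `b` form a directed set with join `a ⊔ b`.
-/
theorem exists_compact_le_of_le_sup (hA : IsCoherentQuantale A) {a b k : A}
    (hk : IsCompactElement k) (h : k ≤ a ⊔ b) :
    ∃ c d, IsCompactElement c ∧ IsCompactElement d ∧ c ≤ a ∧ d ≤ b ∧ k ≤ c ⊔ d := by
  let s : Set A := {x | ∃ c d, IsCompactElement c ∧ IsCompactElement d ∧ c ≤ a ∧ d ≤ b ∧ x = c ⊔ d}
  have hbot : IsCompactElement (⊥ : A) := fun s _ ⟨x, hx⟩ _ _ _ => ⟨x, hx, bot_le⟩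
  have hsup : ∀ c d : A, IsCompactElement c → IsCompactElement d → IsCompactElement (c ⊔ d) := by
    classical
    intro c d hc hd
    simpa using CompleteLattice.isCompactElement_finsetSup (f := id) {c, d} (by simp [hc, hd])
  have hdir : DirectedOn (· ≤ ·) s := by
    rintro _ ⟨c, d, hc, hd, hca, hdb, rfl⟩ _ ⟨c', d', hc', hd', hca', hdb', rfl⟩
    exact ⟨_, ⟨c ⊔ c', d ⊔ d', hsup _ _ hc hc', hsup _ _ hd hd', sup_le hca hca',
      sup_le hdb hdb', rfl⟩, sup_le_sup le_sup_left le_sup_left,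
      sup_le_sup le_sup_right le_sup_right⟩
  have hle : k ≤ sSup s := h.trans <| sup_le
    (hA.le_iff.2 fun c hc hca => le_sSup ⟨c, ⊥, hc, hbot, hca, bot_le, by simp⟩)
    (hA.le_iff.2 fun d hd hdb => le_sSup ⟨⊥, d, hbot, hd, bot_le, hdb, by simp⟩)
  obtain ⟨_, ⟨c, d, hc, hd, hca, hdb, rfl⟩, hkx⟩ :=
    hk s _ ⟨_, ⊥, ⊥, hbot, hbot, bot_le, bot_le, rfl⟩ hdir (isLUB_sSup s) hle
  exact ⟨c, d, hc, hd, hca, hdb, hkx⟩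

variable [IsQuantale A] [IsIntegralQuantale A]

theorem exists_isMPrime_ge (hA : IsCoherentQuantale A) {a : A} (ha : a ≠ 1) :
    ∃ p, IsMPrime p ∧ a ≤ p := by
  obtain ⟨p, hp, hap, -⟩ := exists_isMPrime_of_submonoid (⊥ : Submonoid A)
    (by simpa using hA.compact_one) a
    (by simpa using fun h => ha (le_antisymm (le_one a) h))
  exact ⟨p, hp, hap⟩

/-- Prime separation applied to the powers of `c`, which are compact by coherence. -/
theorem exists_pow_le (hA : IsCoherentQuantale A) {a c : A} (hc : IsCompactElement c)
    (h : ∀ p, IsMPrime p → a ≤ p → c ≤ p) : ∃ n : ℕ, c ^ n ≤ a := by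
  by_contra! hn
  obtain ⟨p, hp, hap, hcp⟩ := exists_isMPrime_of_submonoid (Submonoid.powers c)
    (fun s hs => (Submonoid.powers_le (P := hA.compactSubmonoid)).2 hc hs) a
    (by rintro _ ⟨n, rfl⟩; exact hn n)
  exact hcp c (Submonoid.mem_powers c) (h p hp hap)

theorem isMpQuantale_iff_sup_eq_one (hA : IsCoherentQuantale A) :
    IsMpQuantale A ↔ ∀ p q : A, IsMinMPrime p → IsMinMPrime q → p ≠ q → p ⊔ q = 1 := by
  constructor
  · intro h p q hp hq hpq
    by_contra hne
    obtain ⟨m, hm, hle⟩ := hA.exists_isMPrime_ge hne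
    exact hpq ((h m hm).unique ⟨hp, le_sup_left.trans hle⟩ ⟨hq, le_sup_right.trans hle⟩)
  · intro h m hm
    obtain ⟨q, hq, hqm⟩ := hm.exists_isMinMPrime_le
    refine ⟨q, ⟨hq, hqm⟩, fun p hp => ?_⟩
    by_contra hpq
    exact hm.not_one_le ((h p q hp.1 hq hpq).symm.le.trans (sup_le hp.2 hqm))

end IsCoherentQuantale

/-! ### The Zariski and flat topologies. -/

section Topology

variable {A : Type*} [CommMonoid A] [CompleteLattice A] [IsQuantale A] [IsIntegralQuantale A]

theorem isOpen_iff_exists_V {U : Set (Spec A)} : IsOpen U ↔ ∃ a : A, U = (V a)ᶜ :=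
  ⟨fun ⟨a, ha⟩ => ⟨a, by rw [ha, compl_compl]⟩, fun ⟨a, ha⟩ => ⟨a, by rw [ha, compl_compl]⟩⟩

theorem IsCoherentQuantale.isCompact_compl_V (hA : IsCoherentQuantale A) {c : A}
    (hc : IsCompactElement c) : IsCompact (V c)ᶜ := by
  refine isCompact_of_finite_subcover fun {ι} U hU hcover => ?_
  choose a ha using fun i => isOpen_iff_exists_V.1 (hU i)
  have hrad : ∀ p, IsMPrime p → (⨆ i, a i) ≤ p → c ≤ p := fun p hp hap => by
    by_contra hcp
    obtain ⟨i, hi⟩ := Set.mem_iUnion.1 (hcover (show (⟨p, hp⟩ : Spec A) ∈ (V c)ᶜ from hcp))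
    rw [ha i] at hi
    exact hi ((le_iSup a i).trans hap)
  -- The cover only gives `c ≤ radical (⨆ i, a i)`; a power of `c` gets below the join itself, and
  -- that power is again compact.
  obtain ⟨n, hn⟩ := hA.exists_pow_le hc hrad
  obtain ⟨t, ht⟩ := CompleteLattice.IsCompactElement.exists_finset_of_le_iSup
    A (hA.compactSubmonoid.pow_mem hc n) a hn
  refine ⟨t, fun p hp => ?_⟩
  by_contra hpt
  refine hp (p.2.of_pow_le (ht.trans (iSup₂_le fun i hi => ?_)))
  by_contra hip
  exact hpt (Set.mem_iUnion₂.2 ⟨i, hi, by rw [ha i]; exact hip⟩)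

/-- The compact open sets of the Zariski topology are the complements of the sets `V(c)`, for
compact elements `c`. -/
theorem IsCoherentQuantale.isOpen_and_isCompact_iff (hA : IsCoherentQuantale A)
    {U : Set (Spec A)} :
    IsOpen U ∧ IsCompact U ↔ ∃ c : A, IsCompactElement c ∧ U = (V c)ᶜ := by
  constructor
  · rintro ⟨hU, hUc⟩
    obtain ⟨a, rfl⟩ := isOpen_iff_exists_V.1 hU
    obtain ⟨X, hX, rfl⟩ := hA.algebraic a
    obtain ⟨t, ht⟩ := hUc.elim_finite_subcover (fun x : X => (V x.1)ᶜ)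
      (fun x => isOpen_iff_exists_V.2 ⟨x, rfl⟩) (fun p hp => by
        by_contra h
        simp only [Set.mem_iUnion, not_exists, Set.mem_compl_iff, not_not] at h
        exact hp (sSup_le fun x hx => h ⟨x, hx⟩))
    refine ⟨t.sup Subtype.val,
      CompleteLattice.isCompactElement_finsetSup t fun x _ => hX x x.2, ?_⟩
    refine congrArg _ (Set.Subset.antisymm (fun p hp => ?_) fun p hp => ?_)
    · exact Finset.sup_le fun x _ => (le_sSup x.2).trans hp
    · by_contra hpX
      obtain ⟨x, hx, hxp⟩ := Set.mem_iUnion₂.1 (ht hpX)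
      exact hxp ((Finset.le_sup (f := Subtype.val) hx).trans hp)
  · rintro ⟨c, hc, rfl⟩
    exact ⟨isOpen_iff_exists_V.2 ⟨c, rfl⟩, hA.isCompact_compl_V hc⟩

theorem IsCoherentQuantale.flatSpec_eq_generateFrom (hA : IsCoherentQuantale A) :
    instTopologicalSpaceFlatSpecOfIsQuantaleOfIsIntegralQuantale A =
      TopologicalSpace.generateFrom {s | ∃ c : A, IsCompactElement c ∧ s = flatV c} := by
  refine congrArg TopologicalSpace.generateFrom (Set.ext fun s => ⟨?_, ?_⟩)
  · rintro ⟨U, hU, hUc, rfl⟩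
    obtain ⟨c, hc, rfl⟩ := hA.isOpen_and_isCompact_iff.1 ⟨hU, hUc⟩
    exact ⟨c, hc, compl_compl _⟩
  · rintro ⟨c, hc, rfl⟩
    obtain ⟨h₁, h₂⟩ := hA.isOpen_and_isCompact_iff.2 ⟨c, hc, rfl⟩
    exact ⟨_, h₁, h₂, (compl_compl _).symm⟩

theorem IsCoherentQuantale.isOpen_flatV (hA : IsCoherentQuantale A) {c : A}
    (hc : IsCompactElement c) : IsOpen (flatV c) := by
  rw [hA.flatSpec_eq_generateFrom]
  exact TopologicalSpace.isOpen_generateFrom_of_mem ⟨c, hc, rfl⟩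

/-- Open sets of the flat topology are upward closed. -/
theorem IsCoherentQuantale.mem_of_isOpen_of_le (hA : IsCoherentQuantale A)
    {U : Set (FlatSpec A)} (hU : IsOpen U) {p q : FlatSpec A} (hp : p ∈ U) (hpq : p.1 ≤ q.1) :
    q ∈ U := by
  rw [hA.flatSpec_eq_generateFrom] at hU
  induction hU with
  | basic s hs =>
    obtain ⟨c, -, rfl⟩ := hs
    exact le_trans (show c ≤ p.1 from hp) hpq
  | univ => trivial
  | inter s t _ _ hs ht => exact ⟨hs hp.1, ht hp.2⟩
  | sUnion S _ h =>
    obtain ⟨s, hs, hps⟩ := hp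
    exact ⟨s, hs, h s hs hps⟩

theorem IsCoherentQuantale.mem_of_isClosed_of_le (hA : IsCoherentQuantale A)
    {F : Set (FlatSpec A)} (hF : IsClosed F) {p q : FlatSpec A} (hp : p ∈ F) (hqp : q.1 ≤ p.1) :
    q ∈ F := by
  by_contra hq
  exact hA.mem_of_isOpen_of_le hF.isOpen_compl hq hqp hp

/-- Alexander's subbase theorem reduces to covers by sets `V(c)`. If no product of the `c` involved
is `⊥`, prime separation yields an m-prime above none of them, hence uncovered; if one is, its
finitely many factors give a finite subcover. -/
theorem IsCoherentQuantale.compactSpace_flatSpec (hA : IsCoherentQuantale A) :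
    CompactSpace (FlatSpec A) := by
  refine compactSpace_generateFrom hA.flatSpec_eq_generateFrom fun P hPS hPc => ?_
  let M := Submonoid.closure {c : A | IsCompactElement c ∧ flatV c ∈ P}
  have hM : ∀ s ∈ M, IsCompactElement s := fun s hs =>
    (Submonoid.closure_le (S := hA.compactSubmonoid)).2 (fun c hc => hc.1) hs
  have hcov : ∀ s ∈ M, ∃ Q ⊆ P, Q.Finite ∧ flatV s ⊆ ⋃₀ Q := fun s hs => by
    induction hs using Submonoid.closure_induction with
    | mem c hc => exact ⟨{flatV c}, by simpa using hc.2, Set.finite_singleton _, by simp⟩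
    | one => exact ⟨∅, by simp, Set.finite_empty, fun p hp => absurd hp p.2.not_one_le⟩
    | mul c d _ _ hc hd =>
      obtain ⟨Q, hQ, hQf, hcQ⟩ := hc
      obtain ⟨R, hR, hRf, hdR⟩ := hd
      refine ⟨Q ∪ R, Set.union_subset hQ hR, hQf.union hRf, fun p hp => ?_⟩
      rw [Set.sUnion_union]
      exact (p.2.le_or_le c d hp).imp (fun h => hcQ h) fun h => hdR h
  by_cases hbot : ∃ s ∈ M, s ≤ ⊥
  · obtain ⟨s, hs, hs0⟩ := hbot
    obtain ⟨Q, hQ, hQf, hsQ⟩ := hcov s hs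
    exact ⟨Q, hQ, hQf, Set.eq_univ_of_forall fun p => hsQ (hs0.trans bot_le)⟩
  · push Not at hbot
    obtain ⟨p, hp, -, hpM⟩ := exists_isMPrime_of_submonoid M hM ⊥ hbot
    obtain ⟨s, hsP, hps⟩ := Set.mem_sUnion.1 (hPc.ge (Set.mem_univ (⟨p, hp⟩ : FlatSpec A)))
    obtain ⟨c, hc, rfl⟩ := hPS hsP
    exact absurd hps (hpM c (Submonoid.subset_closure ⟨hc, hsP⟩))

/-- A minimal prime is a closed point of the flat topology. -/
theorem IsCoherentQuantale.isClosed_singleton_flatSpec (hA : IsCoherentQuantale A)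
    {p : FlatSpec A} (hp : IsMinMPrime p.1) : IsClosed {p} := by
  refine isOpen_compl_iff.1 (isOpen_iff_forall_mem_open.2 fun q hq => ?_)
  have hqp : ¬ q.1 ≤ p.1 := fun h => hq (Subtype.ext (hp.eq_of_le q.2 h))
  rw [hA.le_iff] at hqp
  push Not at hqp
  obtain ⟨c, hc, hcq, hcp⟩ := hqp
  refine ⟨flatV c, ?_, hA.isOpen_flatV hc, hcq⟩
  rintro _ h rfl
  exact hcp h

theorem IsCoherentQuantale.disjoint_nhds_flatSpec (hA : IsCoherentQuantale A) {a b : A}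
    (hab : a ⊔ b = 1) {x y : FlatSpec A} (hx : a ≤ x.1) (hy : b ≤ y.1) :
    Disjoint (nhds x) (nhds y) := by
  obtain ⟨c, d, hc, hd, hca, hdb, hcd⟩ := hA.exists_compact_le_of_le_sup hA.compact_one hab.ge
  refine Filter.disjoint_iff.2 ⟨flatV c, (hA.isOpen_flatV hc).mem_nhds (hca.trans hx),
    flatV d, (hA.isOpen_flatV hd).mem_nhds (hdb.trans hy), Set.disjoint_left.2 fun z hzc hzd => ?_⟩
  exact z.2.not_one_le (hcd.trans (sup_le hzc hzd))

/-! ### Condition 2 against retraction, normality and closedness of `V(p)`. -/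

theorem IsCoherentQuantale.sup_eq_one_of_retraction (hA : IsCoherentQuantale A)
    {r : FlatSpec A → FlatMin A} (hr : Continuous r) (hfix : ∀ p : FlatMin A, r p.incl = p)
    {p q : A} (hp : IsMinMPrime p) (hq : IsMinMPrime q) (hpq : p ≠ q) : p ⊔ q = 1 := by
  by_contra hne
  obtain ⟨m, hm, hle⟩ := hA.exists_isMPrime_ge hne
  have key : ∀ x : FlatMin A, x.1.1 ≤ m → r ⟨m, hm⟩ = x := fun x hx => by
    -- The fibre of `r` through `m` is closed, hence contains every prime below `m`.
    have hcl : IsClosed ((fun y => (r y).1) ⁻¹' {(r ⟨m, hm⟩).1}) :=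
      (hA.isClosed_singleton_flatSpec (r ⟨m, hm⟩).2).preimage
        (continuous_subtype_val.comp hr)
    have := hA.mem_of_isClosed_of_le hcl (p := ⟨m, hm⟩) (q := x.incl) rfl hx
    exact (Subtype.ext this).symm.trans (hfix x)
  have h := (key ⟨⟨p, hp.1⟩, hp⟩ (le_sup_left.trans hle)).symm.trans
    (key ⟨⟨q, hq.1⟩, hq⟩ (le_sup_right.trans hle))
  exact hpq (congrArg (fun z : FlatMin A => z.1.1) h)

/-- A minimal prime below `y` stays in the closed set `D`, so it differs from `p`. -/
theorem IsCoherentQuantale.disjoint_nhds_of_minimal_le (hA : IsCoherentQuantale A)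
    (h : ∀ p q : A, IsMinMPrime p → IsMinMPrime q → p ≠ q → p ⊔ q = 1)
    {C D : Set (FlatSpec A)} (hD : IsClosed D) (hCD : Disjoint C D)
    {x y : FlatSpec A} {p : FlatSpec A} (hp : IsMinMPrime p.1) (hpC : p ∈ C) (hpx : p.1 ≤ x.1)
    (hy : y ∈ D) : Disjoint (nhds x) (nhds y) := by
  obtain ⟨q, hq, hqy⟩ := y.2.exists_isMinMPrime_le
  refine hA.disjoint_nhds_flatSpec (h p.1 q hp hq ?_) hpx hqy
  rintro rfl
  exact Set.disjoint_left.1 hCD hpC (hA.mem_of_isClosed_of_le hD hy hqy)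

theorem IsCoherentQuantale.exists_retraction (hA : IsCoherentQuantale A)
    (h : ∀ p q : A, IsMinMPrime p → IsMinMPrime q → p ≠ q → p ⊔ q = 1) :
    ∃ r : FlatSpec A → FlatMin A, Continuous r ∧ ∀ p : FlatMin A, r p.incl = p := by
  have := hA.compactSpace_flatSpec
  choose f hmin hle using fun p : FlatSpec A => p.2.exists_isMinMPrime_le
  let r : FlatSpec A → FlatMin A := fun p => ⟨⟨f p, (hmin p).1⟩, hmin p⟩
  refine ⟨r, ?_, fun p => Subtype.ext (Subtype.ext (p.2.eq_of_le (hmin p.1).1 (hle p.1)))⟩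
  suffices Continuous fun p => (r p).1 from this.subtype_mk _
  have hgen : @Continuous _ _ _ (TopologicalSpace.generateFrom
      {s | ∃ c : A, IsCompactElement c ∧ s = flatV c}) fun p => (r p).1 := by
    rw [continuous_generateFrom_iff]
    rintro _ ⟨c, hc, rfl⟩
    refine isOpen_iff_mem_nhds.2 fun x hx => ?_
    have hclosed : IsClosed (flatV c)ᶜ := (hA.isOpen_flatV hc).isClosed_compl
    have hdisj : Disjoint (nhds x) (nhdsSet (flatV c)ᶜ) :=
      hclosed.isCompact.disjoint_nhdsSet_right.2 fun y hy =>
        hA.disjoint_nhds_of_minimal_le h hclosed disjoint_compl_right (p := (r x).1) (r x).2 hx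
          (hle x) hy
    obtain ⟨U, hU, W, hW, hUW⟩ := Filter.disjoint_iff.1 hdisj
    obtain ⟨W', hW', hsub, hWW⟩ := mem_nhdsSet_iff_exists.1 hW
    filter_upwards [hU] with y hy
    by_contra hyc
    -- If `r y` is outside `V(c)`, it lies in the open set `W'`, and so does `y` above it; but `y ∈
    -- U`.
    exact Set.disjoint_left.1 hUW hy (hWW (hA.mem_of_isOpen_of_le hW' (hsub hyc) (hle y)))
  rwa [← hA.flatSpec_eq_generateFrom] at hgen

theorem IsCoherentQuantale.normalSpace_flatSpec (hA : IsCoherentQuantale A)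
    (h : ∀ p q : A, IsMinMPrime p → IsMinMPrime q → p ≠ q → p ⊔ q = 1) :
    NormalSpace (FlatSpec A) := by
  have := hA.compactSpace_flatSpec
  refine ⟨fun C D hC hD hCD => separatedNhds_iff_disjoint.2 ?_⟩
  rw [hC.isCompact.disjoint_nhdsSet_left]
  intro x hx
  rw [hD.isCompact.disjoint_nhdsSet_right]
  intro y hy
  obtain ⟨p, hp, hpx⟩ := x.2.exists_isMinMPrime_le
  exact hA.disjoint_nhds_of_minimal_le h hD hCD (p := ⟨p, hp.1⟩) hp
    (hA.mem_of_isClosed_of_le hC hx hpx) hpx hy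

theorem IsCoherentQuantale.sup_eq_one_of_normalSpace (hA : IsCoherentQuantale A)
    [NormalSpace (FlatSpec A)] {p q : A} (hp : IsMinMPrime p) (hq : IsMinMPrime q) (hpq : p ≠ q) :
    p ⊔ q = 1 := by
  by_contra hne
  obtain ⟨m, hm, hle⟩ := hA.exists_isMPrime_ge hne
  obtain ⟨U, W, hU, hW, hpU, hqW, hUW⟩ := normal_separation
    (hA.isClosed_singleton_flatSpec (p := ⟨p, hp.1⟩) hp)
    (hA.isClosed_singleton_flatSpec (p := ⟨q, hq.1⟩) hq)
    (Set.disjoint_singleton.2 fun h => hpq (congrArg Subtype.val h))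
  exact Set.disjoint_left.1 hUW
    (hA.mem_of_isOpen_of_le hU (hpU rfl) (q := ⟨m, hm⟩) (le_sup_left.trans hle))
    (hA.mem_of_isOpen_of_le hW (hqW rfl) (le_sup_right.trans hle))

theorem IsCoherentQuantale.isClosed_flatV (hA : IsCoherentQuantale A)
    (h : ∀ p q : A, IsMinMPrime p → IsMinMPrime q → p ≠ q → p ⊔ q = 1) {p : A}
    (hp : IsMinMPrime p) : IsClosed (flatV p) := by
  refine isOpen_compl_iff.1 (isOpen_iff_forall_mem_open.2 fun x hx => ?_)
  obtain ⟨q, hq, hqx⟩ := x.2.exists_isMinMPrime_le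
  have hpq : p ≠ q := by rintro rfl; exact hx hqx
  obtain ⟨c, d, -, hd, hcp, hdq, hcd⟩ :=
    hA.exists_compact_le_of_le_sup hA.compact_one (h p q hp hq hpq).ge
  exact ⟨flatV d, fun z hzd hzp => z.2.not_one_le (hcd.trans (sup_le (hcp.trans hzp) hzd)),
    hA.isOpen_flatV hd, hdq.trans hqx⟩

theorem IsCoherentQuantale.sup_eq_one_of_isClosed_flatV (hA : IsCoherentQuantale A)
    (h : ∀ p : A, IsMinMPrime p → IsClosed (flatV p)) {p q : A} (hp : IsMinMPrime p)
    (hq : IsMinMPrime q) (hpq : p ≠ q) : p ⊔ q = 1 := by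
  by_contra hne
  obtain ⟨m, hm, hle⟩ := hA.exists_isMPrime_ge hne
  exact hpq (hq.eq_of_le hp.1 (hA.mem_of_isClosed_of_le (h p hp) (p := ⟨m, hm⟩) (q := ⟨q, hq.1⟩)
    (le_sup_left.trans hle) (le_sup_right.trans hle)))

end Topology

end QuantaleSpectrum

open QuantaleSpectrum

theorem theorem8p14 {A : Type*} [CommMonoid A] [CompleteLattice A] [IsQuantale A]
    [IsIntegralQuantale A] (hA : IsCoherentQuantale A) :
    List.TFAE [
      IsMpQuantale A,
      ∀ p q : A, IsMinMPrime p → IsMinMPrime q → p ≠ q → p ⊔ q = 1,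
      IsMpFrame (RadicalElements A),
      IsMpQuantale (Above (radical (⊥ : A))),
      ∃ r : FlatSpec A → FlatMin A, Continuous r ∧ ∀ p : FlatMin A, r p.incl = p,
      NormalSpace (FlatSpec A),
      ∀ p : A, IsMinMPrime p → IsClosed (flatV p)] := by
  tfae_have 1 ↔ 2 := hA.isMpQuantale_iff_sup_eq_one
  tfae_have 1 ↔ 3 := isMpQuantale_iff_isMpFrame_radicalElements
  tfae_have 1 ↔ 4 := isMpQuantale_iff_above fun p hp => (radical_le_iff hp).2 bot_le
  tfae_have 2 → 5 := hA.exists_retraction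
  tfae_have 5 → 2 := fun ⟨_, hr, hfix⟩ _ _ => hA.sup_eq_one_of_retraction hr hfix
  tfae_have 2 → 6 := hA.normalSpace_flatSpec
  tfae_have 6 → 2 := fun _ _ _ => hA.sup_eq_one_of_normalSpace
  tfae_have 2 → 7 := fun h _ => hA.isClosed_flatV h
  tfae_have 7 → 2 := fun h _ _ => hA.sup_eq_one_of_isClosed_flatV h
  tfae_finish
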